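/- Let $\mathbb{T}=t_0t_1t_2\ldots=0110100110010110\ldots\in\{0,1\}^{\omega}$ be the Thue–Morse word, where $t_n$ is the sum modulo $2$ of the binary digits of $n$. Let $T$ denote the shift $(x_n)_{n\ge 0}\mapsto(x_{n+1})_{n\ge 0}$ on $\{0,1\}^{\omega}$, and put $d(x,y)=2^{-\min\{k\,:\,x_k\ne y_k\}}$ for $x\neq y$ and $d(x,x)=0$. Two words $x,y$ are *proximal* if for every $\varepsilon>0$ there is $n\ge 0$ with $d(T^n(x),T^n(y))<\varepsilon$. A word $x$ is *distal* if the only point proximal to $x$ in its shift orbit closure $\Omega(x)=\overline{\{T^n(x) : n\ge 0\}}$ is $x$ itself. A set $A$ of non-negative integers is an *IP-set* if there is an infinite sequence $(x_i)_{i\ge 1}$ of positive integers such that $\sum_{i\in F}x_i\in A$ for every finite non-empty set $F$ of indices. For a word $x=x_0x_1x_2\ldots$ and $a\in\{0,1\}$ let $x\big|_a=\{m\ge 0 : x_m=a\}$. **Corollary 3.5.** The Thue–Morse word $\mathbb{T}$ is distal. In particular, for each $n\ge 0$, exactly one of the two sets $T^n(\mathbb{T})\big|_0$ and $T^n(\mathbb{T})\big|_1$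 is an IP-set. -/

import Mathlib

/-- The shift `(xₙ)ₙ ↦ (xₙ₊₁)ₙ` on right infinite words over `A`, a word being a map `ℕ → A`. -/
def shift {A : Type*} (x : ℕ → A) : ℕ → A := fun n => x (n + 1)

/-- The distance `d(x, y) = (1 / 2) ^ min {k | xₖ ≠ yₖ}` for `x ≠ y`, and `d(x, x) = 0`. -/
noncomputable def wordDist {A : Type*} (x y : ℕ → A) : ℝ :=
  (PiNat.dist (E := fun _ : ℕ => A)).dist x y

/-- Two words are proximal if some common shift brings them arbitrarily close together. -/
def Proximal {A : Type*} (x y : ℕ → A) : Prop :=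
  ∀ ε : ℝ, 0 < ε → ∃ n : ℕ, wordDist (shift^[n] x) (shift^[n] y) < ε

/-- The shift orbit closure of a word over a discrete alphabet, taken in the product topology
(which is the topology of `wordDist`). -/
def orbitClosure {A : Type*} [TopologicalSpace A] [DiscreteTopology A] (x : ℕ → A) :
    Set (ℕ → A) :=
  closure (Set.range fun n : ℕ => shift^[n] x)

/-- A word is distal if the only point of its shift orbit closure proximal to it is itself. -/
def IsDistal {A : Type*} [TopologicalSpace A] [DiscreteTopology A] (x : ℕ → A) : Prop :=
  {y ∈ orbitClosure x | Proximal x y} = {x}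

/-- The set of occurrences of the finite word `u` in the infinite word `x`
(positions are counted from `0`). -/
def occurrences {A : Type*} (x : ℕ → A) (u : List A) : Set ℕ :=
  {n | ∀ (i : ℕ) (hi : i < u.length), x (n + i) = u[i]}

/-- `S` is an IP-set: it contains all finite sums of distinct terms of some infinite sequence of
positive integers. -/
def IsIPSet (S : Set ℕ) : Prop :=
  ∃ x : ℕ → ℕ, (∀ i, 0 < x i) ∧ ∀ F : Finset ℕ, F.Nonempty → ∑ i ∈ F, x i ∈ S

/-- The Thue–Morse word: its `n`-th letter is the sum modulo `2` of the binary digits of `n`. -/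
def thueMorse (n : ℕ) : Fin 2 := Fin.ofNat 2 (Nat.digits 2 n).sum

/-!
The Thue–Morse word `t` satisfies `t (2 ^ k * q + r) = t q + t r` in `ℤ/2` for `r < 2 ^ k`
(`thueMorse_two_pow_mul_add`), and everything follows from this identity.

*Distality.* Two equal factors of `t` that are long enough in terms of `k` occur at positions
congruent modulo `2 ^ k` (`thueMorse_recognizable`). If `y` in the orbit closure is proximal to
`t`, then `y` agrees with `t` on a long window, while any prefix of `y` is a factor `t p, t (p + 1), …`
of `t`; comparing the two occurrences of the window shows `2 ^ k ∣ p`. Hence `y` agrees on its first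
`2 ^ k` letters with `t` or with its complement, for every `k`, so `y` is `t` or its complement, and the
complement agrees with `t` nowhere.

*IP-sets.* In a finite sum of distinct numbers `3 * 4 ^ i` the binary digits do not overlap, so `t`
vanishes on it; multiplying by a power of two larger than `n`, one gets finite sums `s` with
`t (n + s) = t n`. Conversely, suppose all finite sums `s` of
a sequence satisfied `t (n + s) ≠ t n`. By the pigeonhole principle there are finite sums divisible
by any given number (`exists_dvd_sum`); taking `s` divisible by a power of two larger than `n`, and
then `s'` from later terms divisible by a power of two larger than `n + s`, one gets
`t (n + s + s') = t n + t s + t s' = t n + 1 + 1 = t n`, a contradiction.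
-/

theorem iterate_shift_apply {A : Type*} (x : ℕ → A) (n i : ℕ) : shift^[n] x i = x (n + i) := by
  induction n generalizing x with
  | zero => simp
  | succ n ih =>
    rw [Function.iterate_succ_apply, ih]
    exact congrArg x (by omega)

theorem mem_occurrences_iterate_shift {A : Type*} (x : ℕ → A) (n m : ℕ) (a : A) :
    m ∈ occurrences (shift^[n] x) [a] ↔ x (n + m) = a := by
  simp [occurrences, iterate_shift_apply]

theorem proximal_refl {A : Type*} (x : ℕ → A) : Proximal x x := fun ε hε =>
  ⟨0, by simpa [wordDist, PiNat.dist_self] using hε⟩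

theorem Proximal.exists_window {A : Type*} {x y : ℕ → A} (h : Proximal x y) (L : ℕ) :
    ∃ n, ∀ i ≤ L, x (n + i) = y (n + i) := by
  obtain ⟨n, hn⟩ := h ((1 / 2) ^ L) (by positivity)
  refine ⟨n, fun i hi => ?_⟩
  have := PiNat.apply_eq_of_dist_lt (E := fun _ : ℕ => A) hn hi
  simpa only [iterate_shift_apply] using this

theorem exists_prefix_of_mem_orbitClosure {A : Type*} [TopologicalSpace A] [DiscreteTopology A]
    {x y : ℕ → A} (h : y ∈ orbitClosure x) (N : ℕ) : ∃ p, ∀ i < N, y i = x (p + i) := by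
  obtain ⟨z, hz, p, rfl⟩ := mem_closure_iff.1 h _
    (PiNat.isOpen_cylinder (fun _ : ℕ => A) y N) (PiNat.self_mem_cylinder y N)
  refine ⟨p, fun i hi => ?_⟩
  have hi' : shift^[p] x i = y i := hz i hi
  rw [← hi', iterate_shift_apply]

/-! ### The Thue–Morse word -/

theorem thueMorse_zero : thueMorse 0 = 0 := by simp [thueMorse]

theorem thueMorse_two_mul (n : ℕ) : thueMorse (2 * n) = thueMorse n := by
  rcases Nat.eq_zero_or_pos n with rfl | hn
  · rfl
  · simp [thueMorse, Nat.digits_def' one_lt_two (show 0 < 2 * n by omega)]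

theorem thueMorse_two_mul_add_one (n : ℕ) : thueMorse (2 * n + 1) = thueMorse n + 1 := by
  have h : (2 * n + 1) / 2 = n := by omega
  simp [thueMorse, h, Fin.ext_iff, Fin.val_add, Nat.add_comm 1]

theorem thueMorse_two_pow_mul_add (k q r : ℕ) (hr : r < 2 ^ k) :
    thueMorse (2 ^ k * q + r) = thueMorse q + thueMorse r := by
  induction k generalizing r with
  | zero =>
    obtain rfl : r = 0 := by simpa using hr
    simp [thueMorse_zero]
  | succ k ih =>
    rw [pow_succ] at hr
    obtain ⟨s, rfl | rfl⟩ := Nat.even_or_odd' r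
    · rw [show 2 ^ (k + 1) * q + 2 * s = 2 * (2 ^ k * q + s) by ring, thueMorse_two_mul,
        thueMorse_two_mul, ih s (by omega)]
    · rw [show 2 ^ (k + 1) * q + (2 * s + 1) = 2 * (2 ^ k * q + s) + 1 by ring,
        thueMorse_two_mul_add_one, thueMorse_two_mul_add_one, ih s (by omega), add_assoc]

theorem thueMorse_add_of_dvd {k m r : ℕ} (hm : 2 ^ k ∣ m) (hr : r < 2 ^ k) :
    thueMorse (r + m) = thueMorse r + thueMorse m := by
  obtain ⟨q, rfl⟩ := hm
  have h0 := thueMorse_two_pow_mul_add k q 0 (by positivity)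
  rw [thueMorse_zero, add_zero, add_zero] at h0
  rw [add_comm r, thueMorse_two_pow_mul_add k q r hr, h0, add_comm]

theorem thueMorse_succ_ne_of_even {n : ℕ} (hn : Even n) : thueMorse (n + 1) ≠ thueMorse n := by
  obtain ⟨m, rfl⟩ := hn.two_dvd
  rw [thueMorse_two_mul_add_one, thueMorse_two_mul]
  generalize thueMorse m = x
  revert x
  decide

theorem thueMorse_no_cube_letter (n : ℕ) :
    ¬ (thueMorse (n + 1) = thueMorse n ∧ thueMorse (n + 2) = thueMorse (n + 1)) := by
  rintro ⟨h1, h2⟩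
  rcases Nat.even_or_odd n with h | h
  · exact thueMorse_succ_ne_of_even h h1
  · exact thueMorse_succ_ne_of_even h.add_one h2

/-- A factor of length five determines the parity of its position: at two positions of different
parity it would be an alternating word, hence the image of a cube of a letter. -/
theorem thueMorse_not_even_odd {a b : ℕ} (ha : Even a) (hb : Odd b)
    (h : ∀ i < 5, thueMorse (a + i) = thueMorse (b + i)) : False := by
  have a0 := thueMorse_succ_ne_of_even ha
  have a2 := thueMorse_succ_ne_of_even (ha.add even_two)
  have b1 := thueMorse_succ_ne_of_even hb.add_one
  have b3 := thueMorse_succ_ne_of_even (hb.add_one.add even_two)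
  rw [add_assoc, ← h 1 (by norm_num), ← h 2 (by norm_num)] at b1
  change thueMorse (b + 4) ≠ thueMorse (b + 3) at b3
  rw [← h 3 (by norm_num), ← h 4 (by norm_num)] at b3
  obtain ⟨c, rfl⟩ := ha.two_dvd
  have e2 : thueMorse (2 * c + 2) = thueMorse (c + 1) := thueMorse_two_mul (c + 1)
  have e4 : thueMorse (2 * c + 4) = thueMorse (c + 2) := thueMorse_two_mul (c + 2)
  have two : ∀ x y z : Fin 2, x ≠ y → z ≠ y → x = z := by decide
  refine thueMorse_no_cube_letter c ⟨?_, ?_⟩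
  · rw [← e2, ← thueMorse_two_mul c]
    exact two _ _ _ b1 a0.symm
  · rw [← e2, ← e4]
    exact two _ _ _ b3 a2.symm

/-- Recognizability: a factor of length `8 * 2 ^ k` determines its position modulo `2 ^ k`. -/
theorem thueMorse_recognizable (k : ℕ) {a b : ℕ}
    (h : ∀ i < 8 * 2 ^ k, thueMorse (a + i) = thueMorse (b + i)) : a ≡ b [MOD 2 ^ k] := by
  induction k generalizing a b with
  | zero => simpa using Nat.modEq_one
  | succ k ih =>
    have hk : 0 < 2 ^ k := by positivity
    rw [pow_succ] at h
    have h5 : ∀ i < 5, thueMorse (a + i) = thueMorse (b + i) := fun i hi => h i (by omega)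
    have key : ∀ c d e : ℕ, e ≤ 1 → a + e = 2 * c → b + e = 2 * d → a ≡ b [MOD 2 ^ (k + 1)] := by
      intro c d e he hc hd
      have hcd : c ≡ d [MOD 2 ^ k] := ih fun i hi => by
        rw [← thueMorse_two_mul, ← thueMorse_two_mul (d + i), mul_add, mul_add, ← hc, ← hd,
          add_assoc, add_assoc]
        exact h _ (by omega)
      refine Nat.ModEq.add_right_cancel' e ?_
      rw [hc, hd, pow_succ']
      exact hcd.mul_left' 2
    rcases Nat.even_or_odd a with ha | ha <;> rcases Nat.even_or_odd b with hb | hb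
    · obtain ⟨c, hc⟩ := ha.two_dvd
      obtain ⟨d, hd⟩ := hb.two_dvd
      exact key c d 0 (by omega) hc hd
    · exact (thueMorse_not_even_odd ha hb h5).elim
    · exact (thueMorse_not_even_odd hb ha fun i hi => (h5 i hi).symm).elim
    · obtain ⟨c, hc⟩ := ha.add_one.two_dvd
      obtain ⟨d, hd⟩ := hb.add_one.two_dvd
      exact key c d 1 le_rfl hc hd

/-! ### Distality -/

theorem eq_add_of_mem_orbitClosure_of_proximal {y : ℕ → Fin 2} (hy : y ∈ orbitClosure thueMorse)
    (hp : Proximal thueMorse y) (m : ℕ) : y m = thueMorse m + y 0 := by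
  have hm : m < 2 ^ m := Nat.lt_two_pow_self
  obtain ⟨n, hn⟩ := hp.exists_window (8 * 2 ^ m)
  obtain ⟨p, hp⟩ := exists_prefix_of_mem_orbitClosure hy (n + 8 * 2 ^ m)
  have hmod : n ≡ p + n [MOD 2 ^ m] := thueMorse_recognizable m fun i hi => by
    rw [hn i hi.le, hp _ (by omega), add_assoc]
  have hdvd : 2 ^ m ∣ p :=
    (Nat.modEq_zero_iff_dvd).1 (Nat.ModEq.add_right_cancel' n (by simpa using hmod.symm))
  rw [hp m (by omega), hp 0 (by omega), add_zero, add_comm p, thueMorse_add_of_dvd hdvd hm]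

theorem isDistal_thueMorse : IsDistal thueMorse := by
  ext y
  simp only [Set.mem_ofPred_eq, Set.mem_singleton_iff]
  constructor
  · rintro ⟨hy, hp⟩
    have h := eq_add_of_mem_orbitClosure_of_proximal hy hp
    obtain ⟨n, hn⟩ := hp.exists_window 0
    have h0 : y 0 = 0 := by
      have := h n
      rw [← show thueMorse n = y n from hn 0 le_rfl] at this
      exact left_eq_add.1 this
    funext m
    rw [h m, h0, add_zero]
  · rintro rfl
    exact ⟨subset_closure ⟨0, rfl⟩, proximal_refl _⟩

/-! ### IP-sets -/

theorem exists_dvd_sum (x : ℕ → ℕ) (N d : ℕ) (hd : 0 < d) :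
    ∃ F : Finset ℕ, F.Nonempty ∧ (∀ i ∈ F, N ≤ i) ∧ d ∣ ∑ i ∈ F, x i := by
  have : NeZero d := ⟨hd.ne'⟩
  -- Two of the partial sums starting at `N` agree modulo `d`.
  obtain ⟨i, j, hij, h⟩ := Finite.exists_ne_map_eq_of_infinite
    fun i : ℕ => ((∑ l ∈ Finset.Ico N (N + i), x l : ℕ) : ZMod d)
  wlog hlt : i < j generalizing i j
  · exact this j i hij.symm h.symm (by omega)
  refine ⟨Finset.Ico (N + i) (N + j), by simpa using hlt, fun l hl => ?_, ?_⟩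
  · have := (Finset.mem_Ico.1 hl).1
    omega
  · rw [← ZMod.natCast_eq_zero_iff]
    have hs := Finset.sum_Ico_consecutive x (Nat.le_add_right N i)
      (show N + i ≤ N + j by omega)
    have h' := congrArg (Nat.cast (R := ZMod d)) hs
    rw [Nat.cast_add, ← h] at h'
    exact left_eq_add.1 h'.symm

theorem isIPSet_thueMorse_eq (n : ℕ) : IsIPSet {m | thueMorse (n + m) = thueMorse n} := by
  refine ⟨fun i => 2 ^ n * (3 * 4 ^ i), fun i => by positivity, fun F hF => ?_⟩
  clear hF
  rw [← Finset.mul_sum, Set.mem_ofPred_eq, add_comm,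
    thueMorse_two_pow_mul_add _ _ _ Nat.lt_two_pow_self]
  suffices thueMorse (∑ i ∈ F, 3 * 4 ^ i) = 0 by rw [this, zero_add]
  induction F using Finset.induction_on_max with
  | empty => simpa using thueMorse_zero
  | insert a s hs ih =>
    rw [Finset.sum_insert fun h => (hs a h).false]
    -- The terms of index less than `a` add up to a number with at most `2 * a` binary digits.
    have hlt : ∑ i ∈ s, 3 * 4 ^ i < 2 ^ (2 * a) := by
      have hle : ∑ i ∈ s, 3 * 4 ^ i ≤ ∑ i ∈ Finset.range a, 3 * 4 ^ i :=
        Finset.sum_le_sum_of_subset fun i hi => Finset.mem_range.2 (hs i hi)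
      have hgeom : ∀ b : ℕ, ∑ i ∈ Finset.range b, 3 * 4 ^ i + 1 = 4 ^ b := by
        intro b
        induction b with
        | zero => simp
        | succ b ihb => rw [Finset.sum_range_succ, pow_succ]; omega
      have := hgeom a
      rw [pow_mul]
      norm_num
      omega
    rw [show 3 * 4 ^ a = 2 ^ (2 * a) * 3 by rw [pow_mul]; norm_num; ring,
      thueMorse_two_pow_mul_add _ _ _ hlt, ih, add_zero]
    simp [thueMorse]

theorem not_isIPSet_thueMorse_ne (n : ℕ) : ¬ IsIPSet {m | thueMorse (n + m) ≠ thueMorse n} := by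
  rintro ⟨x, -, hx⟩
  have two : ∀ a b : Fin 2, a + b ≠ a → b = 1 := by decide
  obtain ⟨F, hF, -, hFd⟩ := exists_dvd_sum x 0 (2 ^ n) (by positivity)
  have hFx := hx F hF
  rw [Set.mem_ofPred_eq, thueMorse_add_of_dvd hFd Nat.lt_two_pow_self] at hFx
  obtain ⟨G, hG, hGF, hGd⟩ :=
    exists_dvd_sum x (F.sup id + 1) (2 ^ (n + ∑ i ∈ F, x i)) (by positivity)
  have hdisj : Disjoint F G := Finset.disjoint_left.2 fun i hi hi' => by
    have h1 : i ≤ F.sup id := Finset.le_sup (f := id) hi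
    have h2 := hGF i hi'
    omega
  have hGx := hx G hG
  rw [Set.mem_ofPred_eq, thueMorse_add_of_dvd hGd
    (lt_of_le_of_lt (Nat.le_add_right _ _) Nat.lt_two_pow_self)] at hGx
  have hFGx := hx (F ∪ G) (hF.mono Finset.subset_union_left)
  rw [Set.mem_ofPred_eq, Finset.sum_union hdisj, ← add_assoc,
    thueMorse_add_of_dvd hGd Nat.lt_two_pow_self,
    thueMorse_add_of_dvd hFd Nat.lt_two_pow_self, two _ _ hFx, two _ _ hGx, add_assoc] at hFGx
  exact hFGx (add_zero _)

theorem corollary3p5 :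
    IsDistal thueMorse ∧
      ∀ n : ℕ, Xor (IsIPSet (occurrences (shift^[n] thueMorse) [0]))
        (IsIPSet (occurrences (shift^[n] thueMorse) [1])) := by
  refine ⟨isDistal_thueMorse, fun n => ?_⟩
  have hocc : ∀ a : Fin 2, occurrences (shift^[n] thueMorse) [a] = {m | thueMorse (n + m) = a} :=
    fun a => Set.ext fun m => mem_occurrences_iterate_shift _ _ _ _
  have heq := isIPSet_thueMorse_eq n
  have hne := not_isIPSet_thueMorse_ne n
  have two : ∀ a : Fin 2, a = 0 ∨ a = 1 := by decide
  have ne_zero : ∀ a : Fin 2, a ≠ 0 ↔ a = 1 := by decide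
  have ne_one : ∀ a : Fin 2, a ≠ 1 ↔ a = 0 := by decide
  rw [hocc, hocc]
  rcases two (thueMorse n) with h | h
  · simp only [h, ne_zero] at heq hne
    exact Or.inl ⟨heq, hne⟩
  · simp only [h, ne_one] at heq hne
    exact Or.inr ⟨heq, hne⟩
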